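/- Let $d\ge 1$ and let $u:\mathbb{R}^d\to\mathbb{C}$ be a continuous, square-integrable, not identically zero function whose (Plancherel) Fourier transform $\widehat{u}$, normalised by $\widehat{u}(\xi)=\int_{\mathbb{R}^d}u(x)e^{-2\pi i x\cdot\xi}\,dx$, belongs to $L^1\cap L^\infty$ and is non-negative almost everywhere. Then $k(x,y):=u(x-y)$ is a positive definite kernel on $\mathbb{R}^d$; let $H_k$ be its reproducing kernel Hilbert space and, for $U\subset\mathbb{R}^d$, let $H_{k|_{U^2}}$ be that of the restriction of $k$ to $U\times U$. Write $\|h\|_{L^2(\widehat{u})}=\left(\int_{\mathbb{R}^d}|h(\xi)|^2\,\widehat{u}(\xi)\,d\xi\right)^{1/2}$, let $P_n\subset\mathbb{C}[\xi_1,\dots,\xi_d]$ be the space of polynomials of total degree at most $n$, put $(m_zh)(\xi)=e^{-2\pi i z^{\top}\xi}h(\xi)$ for $z\in\mathbb{C}^d$, and let $\mathcal{G}(u)$ be the set of all $A\in\mathrm{GL}_d(\mathbb{R})$ for which there is $\lambda>0$ with $\widehat{u}(A^{\top}\xi)\ge\lambda\,\widehat{u}(\xi)$ for almost every $\xi$.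 Suppose that (A) for every $a>0$ there is $c_a>0$ such that $|\widehat{u}(\xi)|\le c_ae^{-a|\xi|}$ for almost every $\xi$; (B) $\displaystyle\sup_{z\in\mathbb{C}^d}\left(\limsup_{n\to\infty}\sqrt[n]{\sup_{P\in P_n\setminus\{0\}}\frac{\|m_zP\|_{L^2(\widehat{u})}}{\|P\|_{L^2(\widehat{u})}}}\right)<\infty$; (C) $\mathcal{G}(u)$ spans the real vector space $\mathrm{M}_d(\mathbb{R})$. Then for every non-empty open set $U\subset\mathbb{R}^d$ and every map $f:U\to\mathbb{R}^d$, the composition operator $C_f:H_k\to H_{k|_{U^2}}$, $C_f(h)=h\circ f$, with domain $\mathcal{D}(C_f)=\{h\in H_k: h\circ f\in H_{k|_{U^2}}\}$, is not a compact operator; that is, it is not the case that $\mathcal{D}(C_f)=H_k$ and $C_f$ is compact. -/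

import Mathlib

open MeasureTheory Filter
open scoped ENNReal SchwartzMap FourierTransform ComplexConjugate ComplexOrder

/-- A function `k : X × X → ℂ` is positive definite if
`∑_{p,q ∈ F} conj (c p) * c q * k p q ≥ 0` for every finite `F ⊆ X` and every `c : X → ℂ`
(in the order of `ℂ`, so the sum is in particular real). -/
def IsPosDefKernel {X : Type*} (k : X → X → ℂ) : Prop :=
  ∀ (F : Finset X) (c : X → ℂ), 0 ≤ ∑ p ∈ F, ∑ q ∈ F, conj (c p) * c q * k p q

/-- A scalar kernel as an operator-valued one: `k x y` acts on `ℂ` by multiplication. -/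
noncomputable def kernelMatrix {X : Type*} (k : X → X → ℂ) : Matrix X X (ℂ →L[ℂ] ℂ) :=
  Matrix.of fun x y => k x y • ContinuousLinearMap.id ℂ ℂ

theorem IsPosDefKernel.conj_symm {X : Type*} {k : X → X → ℂ} (hk : IsPosDefKernel k) (p q : X) :
    conj (k q p) = k p q := by
  classical
  have diag : ∀ r, (k r r).im = 0 := fun r => by
    have := (Complex.le_def.1 (hk {r} (fun _ => 1))).2
    simpa using this.symm
  by_cases hpq : p = q
  · subst hpq
    apply Complex.ext <;> simp [diag]
  · have h1 := (Complex.le_def.1 (hk {p, q} (fun _ => 1))).2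
    have h2 := (Complex.le_def.1 (hk {p, q} (fun x => if x = p then 1 else Complex.I))).2
    simp [Finset.sum_pair hpq, diag, Ne.symm hpq] at h1 h2
    apply Complex.ext <;> simp <;> linarith

theorem IsPosDefKernel.posSemidef {X : Type*} {k : X → X → ℂ} (hk : IsPosDefKernel k) :
    (kernelMatrix k).PosSemidef := by
  have hiff := (RKHS.posSemidef_tfae (K := kernelMatrix k)).out 0 2
  refine hiff.2 ⟨?_, fun v => ?_⟩
  · ext p q
    simp [kernelMatrix, Matrix.conjTranspose_apply, ← hk.conj_symm p q,
      ContinuousLinearMap.star_eq_adjoint, ContinuousLinearMap.adjoint_id]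
  · have h := (Complex.le_def.1 (hk v.support v)).1
    rw [Finset.sum_comm] at h
    refine h.trans (le_of_eq ?_)
    simp only [Finsupp.sum, map_sum, Complex.re_sum]
    refine Finset.sum_congr rfl fun x _ => Finset.sum_congr rfl fun y _ => ?_
    simp [kernelMatrix]
    ring

/-- Pulling back along an injection, in particular restricting to a subset, preserves positive
definiteness. -/
theorem IsPosDefKernel.comp {X Y : Type*} {k : Y → Y → ℂ} (hk : IsPosDefKernel k) {g : X → Y}
    (hg : Function.Injective g) : IsPosDefKernel fun x y => k (g x) (g y) := by
  classical
  intro F c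
  have := hk (F.image g) (Function.extend g c 0)
  simpa [Finset.sum_image hg.injOn, hg.extend_apply] using this

/-- The Euclidean space `ℝ^d`. -/
abbrev Eu (d : ℕ) : Type := EuclideanSpace ℝ (Fin d)

/-- The Fourier transform `û` of a square-integrable `u`, an element of `L²(ℝ^d)`
(the Plancherel extension of `û(ξ) = ∫ u(x) exp(-2πi x·ξ) dx`). -/
noncomputable def fourierL2 {d : ℕ} {u : Eu d → ℂ} (hu : MemLp u 2) : Lp (α := Eu d) ℂ 2 :=
  𝓕 (hu.toLp u)

/-- Fourier inversion for a continuous `u ∈ L²` with integrable transform. -/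
theorem eq_fourierInv {d : ℕ} {u : Eu d → ℂ} (hu : MemLp u 2) (hc : Continuous u)
    (h1 : Integrable (fourierL2 hu : Eu d → ℂ)) : u = 𝓕⁻ (fourierL2 hu : Eu d → ℂ) := by
  set V : Lp (α := Eu d) ℂ 2 := fourierL2 hu with hV
  have hcont : Continuous (𝓕⁻ (V : Eu d → ℂ)) := by
    rw [← Real.Lp.fourierTransformInv_toLp (memLp_one_iff_integrable.2 h1)]
    exact (Real.Lp.fourierTransformInv _).continuous
  refine hc.ae_eq_iff_eq (μ := volume) hcont |>.1 ?_
  refine ae_eq_of_integral_contDiff_smul_eq (hu.locallyIntegrable (by norm_num))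
    hcont.locallyIntegrable fun g hg hgs => ?_
  have hg₁ : HasCompactSupport (Complex.ofRealCLM ∘ g) := hgs.comp_left rfl
  have hg₂ : ContDiff ℝ ((⊤ : ℕ∞) : WithTop ℕ∞) (Complex.ofRealCLM ∘ g) := by fun_prop
  have key : 𝓕⁻ (V : 𝓢'(Eu d, ℂ)) = (hu.toLp u : Lp (α := Eu d) ℂ 2) := by
    rw [Lp.fourierInv_toTemperedDistribution_eq, hV, fourierL2, FourierTransform.fourierInv_fourier_eq]
  have h2 := congrArg (fun T => T (hg₁.toSchwartzMap hg₂)) key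
  simp only [TemperedDistribution.fourierInv_apply, Lp.toTemperedDistribution_apply] at h2
  have hfub : ∫ x, (𝓕⁻ (hg₁.toSchwartzMap hg₂)) x • (V : Eu d → ℂ) x =
      ∫ x, (hg₁.toSchwartzMap hg₂) x • 𝓕⁻ (V : Eu d → ℂ) x := by
    have hL : Continuous fun p : Eu d × Eu d => (-innerₗ (Eu d)) p.1 p.2 := continuous_inner.neg
    have hflip : (-innerₗ (Eu d)).flip = -innerₗ (Eu d) := by
      ext x y; simp [real_inner_comm]
    have := VectorFourier.integral_fourierIntegral_smul_eq_flip (L := -innerₗ (Eu d))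
      (μ := volume) (ν := volume) Real.continuous_fourierChar hL
      (hg₁.toSchwartzMap hg₂).integrable h1
    rw [hflip] at this
    rw [SchwartzMap.fourierInv_coe]
    exact this
  have hU : ∫ x, (hg₁.toSchwartzMap hg₂) x • (hu.toLp u : Eu d → ℂ) x =
      ∫ x, (hg₁.toSchwartzMap hg₂) x • u x := by
    refine integral_congr_ae ?_
    filter_upwards [hu.coeFn_toLp] with x hx
    rw [hx]
  rw [hfub, hU] at h2
  simpa using h2.symm

/-- If `û` is integrable and non-negative, then `(x, y) ↦ u (x - y)` is positive definite. -/
theorem isPosDefKernel_of_fourier_nonneg {d : ℕ} {u : Eu d → ℂ} (hu : MemLp u 2)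
    (hc : Continuous u) (h1 : Integrable (fourierL2 hu : Eu d → ℂ))
    (hpos : ∀ᵐ ξ, 0 ≤ (fourierL2 hu : Eu d → ℂ) ξ) :
    IsPosDefKernel fun x y : Eu d => u (x - y) := by
  intro F c
  have hrep := eq_fourierInv hu hc h1
  set V : Eu d → ℂ := (fourierL2 hu : Eu d → ℂ) with hV
  let e : Eu d → Eu d → ℂ := fun p ξ => (Real.fourierChar (inner ℝ ξ p) : ℂ)
  have he : ∀ p q ξ, (Real.fourierChar (inner ℝ ξ (p - q)) : ℂ) = e p ξ * conj (e q ξ) := by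
    intro p q ξ
    simp only [e]
    rw [← Circle.coe_inv_eq_conj, ← Circle.coe_mul, ← AddChar.map_neg_eq_inv,
      ← AddChar.map_add_eq_mul, inner_sub_right, sub_eq_add_neg]
  have hint : ∀ p q, Integrable fun ξ => conj (c p) * c q * (e p ξ * conj (e q ξ) * V ξ) := by
    intro p q
    refine Integrable.const_mul ?_ _
    have := (VectorFourier.fourierIntegral_convergent_iff (μ := volume) (f := V)
      Real.continuous_fourierChar
      (L := -innerₗ (Eu d)) (continuous_inner.neg) (p - q)).2 h1
    refine this.congr (Eventually.of_forall fun ξ => ?_)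
    simp [← he, Circle.smul_def]
  have hkey : ∑ p ∈ F, ∑ q ∈ F, conj (c p) * c q * u (p - q) =
      ∫ ξ, (Complex.normSq (∑ p ∈ F, conj (c p) * e p ξ) : ℂ) * V ξ := by
    have : ∀ ξ, (Complex.normSq (∑ p ∈ F, conj (c p) * e p ξ) : ℂ) * V ξ =
        ∑ p ∈ F, ∑ q ∈ F, conj (c p) * c q * (e p ξ * conj (e q ξ) * V ξ) := by
      intro ξ
      rw [← Complex.mul_conj, map_sum, Finset.sum_mul_sum, Finset.sum_mul]
      refine Finset.sum_congr rfl fun p _ => ?_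
      rw [Finset.sum_mul]
      refine Finset.sum_congr rfl fun q _ => ?_
      simp only [map_mul, Complex.conj_conj]
      ring
    simp_rw [this]
    rw [integral_finsetSum _ fun p _ => integrable_finsetSum _ fun q _ => hint p q]
    refine Finset.sum_congr rfl fun p _ => ?_
    rw [integral_finsetSum _ fun q _ => hint p q]
    refine Finset.sum_congr rfl fun q _ => ?_
    rw [integral_const_mul, hrep, Real.fourierInv_eq]
    congr 1
    refine integral_congr_ae (Eventually.of_forall fun ξ => ?_)
    simp [← he, Circle.smul_def]
  rw [hkey]
  refine integral_nonneg_of_ae ?_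
  filter_upwards [hpos] with ξ hξ
  exact mul_nonneg (by exact_mod_cast Complex.normSq_nonneg _) hξ

noncomputable section

/-- The reproducing kernel Hilbert space `H_k` of a positive definite kernel `k`. -/
def RKHSpace {X : Type*} (k : X → X → ℂ) (hk : IsPosDefKernel k) : Type _ :=
  haveI : Fact (kernelMatrix k).PosSemidef := ⟨hk.posSemidef⟩
  RKHS.OfKernel (kernelMatrix k)

namespace RKHSpace
variable {X : Type*} (k : X → X → ℂ) (hk : IsPosDefKernel k)

instance : NormedAddCommGroup (RKHSpace k hk) :=
  haveI : Fact (kernelMatrix k).PosSemidef := ⟨hk.posSemidef⟩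
  inferInstanceAs (NormedAddCommGroup (RKHS.OfKernel (kernelMatrix k)))

instance : InnerProductSpace ℂ (RKHSpace k hk) :=
  haveI : Fact (kernelMatrix k).PosSemidef := ⟨hk.posSemidef⟩
  inferInstanceAs (InnerProductSpace ℂ (RKHS.OfKernel (kernelMatrix k)))

instance : CompleteSpace (RKHSpace k hk) :=
  haveI : Fact (kernelMatrix k).PosSemidef := ⟨hk.posSemidef⟩
  inferInstanceAs (CompleteSpace (RKHS.OfKernel (kernelMatrix k)))

instance : RKHS ℂ (RKHSpace k hk) X ℂ :=
  haveI : Fact (kernelMatrix k).PosSemidef := ⟨hk.posSemidef⟩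
  inferInstanceAs (RKHS ℂ (RKHS.OfKernel (kernelMatrix k)) X ℂ)

theorem kernel_eq : RKHS.kernel (RKHSpace k hk) = kernelMatrix k :=
  haveI : Fact (kernelMatrix k).PosSemidef := ⟨hk.posSemidef⟩
  RKHS.OfKernel.kernel_ofKernel (K := kernelMatrix k)

/-- The function `k_y = k(·, y)` belongs to `H_k`. -/
theorem kerFun_apply (x y : X) : RKHS.kerFun (RKHSpace k hk) y 1 x = k x y := by
  rw [RKHS.kerFun_apply, kernel_eq]
  simp [kernelMatrix]

/-- The reproducing property `⟨k_y, h⟩ = h(y)`. -/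
theorem inner_kerFun (y : X) (h : RKHSpace k hk) :
    inner ℂ (RKHS.kerFun (RKHSpace k hk) y 1) h = h y := by
  simp

end RKHSpace

section CompositionOperator

variable {X Y H H' : Type*}
  [NormedAddCommGroup H] [InnerProductSpace ℂ H] [RKHS ℂ H Y ℂ]
  [NormedAddCommGroup H'] [InnerProductSpace ℂ H'] [RKHS ℂ H' X ℂ]

variable (H H') in
/-- The composition operator `C_f : H → H'`, `h ↦ h ∘ f`, with domain
`{h ∈ H | h ∘ f ∈ H'}`, for Hilbert function spaces `H` on `Y` and `H'` on `X`, and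
`f : X → Y`. -/
def compositionOp (f : X → Y) : H →ₗ.[ℂ] H' where
  domain :=
    { carrier := {h | ∃ g : H', ∀ x, g x = h (f x)}
      add_mem' := by
        rintro h₁ h₂ ⟨g₁, e₁⟩ ⟨g₂, e₂⟩
        exact ⟨g₁ + g₂, fun x => by simp [e₁, e₂]⟩
      zero_mem' := ⟨0, fun x => by simp⟩
      smul_mem' := by
        rintro c h ⟨g, e⟩
        exact ⟨c • g, fun x => by simp [e]⟩ }
  toFun :=
    { toFun := fun h => h.2.choose
      map_add' := fun h₁ h₂ => RKHS.ext fun x => by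
        have e := (h₁ + h₂).2.choose_spec x
        have e₁ := h₁.2.choose_spec x
        have e₂ := h₂.2.choose_spec x
        refine e.trans ?_
        simp [e₁, e₂]
      map_smul' := fun c h => RKHS.ext fun x => by
        have e := (c • h).2.choose_spec x
        have e₁ := h.2.choose_spec x
        refine e.trans ?_
        simp [e₁] }

theorem mem_compositionOp_domain (f : X → Y) (h : H) :
    h ∈ (compositionOp H H' f).domain ↔ ∃ g : H', (g : X → ℂ) = h ∘ f :=
  exists_congr fun _ => funext_iff.symm

theorem compositionOp_apply (f : X → Y) (h : (compositionOp H H' f).domain) :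
    (compositionOp H H' f h : X → ℂ) = (h : H) ∘ f :=
  funext h.2.choose_spec

end CompositionOperator

/-- A partially defined linear operator `T` from `H` to `H'` is a compact operator `H → H'` if it
is defined on all of `H` and maps some neighbourhood of `0` into a compact set. -/
def LinearPMap.IsCompactOp {H H' : Type*} [NormedAddCommGroup H] [InnerProductSpace ℂ H]
    [NormedAddCommGroup H'] [InnerProductSpace ℂ H'] (T : H →ₗ.[ℂ] H') : Prop :=
  T.domain = ⊤ ∧ IsCompactOperator T.toFun

variable {d : ℕ}

/-- The norm `(∫ |h|² û)^{1/2}` of the weighted space `L²(û)`, with values in `[0, ∞]`. -/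
def weightedNorm {u : Eu d → ℂ} (hu : MemLp u 2) (h : Eu d → ℂ) : ℝ≥0∞ :=
  eLpNorm h 2 (volume.withDensity fun ξ => ENNReal.ofReal (fourierL2 hu ξ).re)

/-- The multiplication `(m_z h)(ξ) = exp(-2πi z^⊤ξ) h(ξ)` for `z ∈ ℂ^d`. -/
def expMul (z : Fin d → ℂ) (h : Eu d → ℂ) (ξ : Eu d) : ℂ :=
  Complex.exp (-2 * Real.pi * Complex.I * ∑ j, z j * (ξ j : ℂ)) * h ξ

/-- The function on `ℝ^d` defined by a complex polynomial in `d` variables. -/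
def polyFun (P : MvPolynomial (Fin d) ℂ) (ξ : Eu d) : ℂ :=
  MvPolynomial.eval (fun j => (ξ j : ℂ)) P

/-- The operator norm of `m_z` on the polynomials of total degree at most `n`, i.e. the supremum
of `‖m_z P‖ / ‖P‖` over the nonzero ones, in the norm of `L²(û)`. -/
def expMulNorm {u : Eu d → ℂ} (hu : MemLp u 2) (z : Fin d → ℂ) (n : ℕ) : ℝ≥0∞ :=
  ⨆ P : {P : MvPolynomial (Fin d) ℂ // P.totalDegree ≤ n ∧ P ≠ 0},
    weightedNorm hu (expMul z (polyFun P)) / weightedNorm hu (polyFun P)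

/-- The set `𝒢(u)` of all `A ∈ GL_d(ℝ)` such that, for some `c > 0`, `û(A^⊤ξ) ≥ c û(ξ)` for
almost every `ξ`. -/
def dilationSet {u : Eu d → ℂ} (hu : MemLp u 2) : Set (Matrix (Fin d) (Fin d) ℝ) :=
  {A | IsUnit A ∧ ∃ c : ℝ, 0 < c ∧ ∀ᵐ ξ : Eu d,
    c * (fourierL2 hu ξ).re ≤ (fourierL2 hu (Matrix.toEuclideanLin A.transpose ξ)).re}

end

/-!
Write `H` for the space of the kernel `u (x - y)` on `ℝ^d` and `H'` for that of its restriction to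
`U`, with kernel functions `κ_y` and `κ'_x`. If the composition operator `C` is compact, it is
bounded and `C* κ'_x = κ_{f(x)}`, a vector of squared norm `u(0)`, whatever `f` is.

The functions `φ_x(ξ) = exp(-2πi x·ξ) √û(ξ)` in `L²(ℝ^d)` have Gram matrix `u (x - y)`, so there is
an isometry `L : H' → L²` with `L κ'_x = φ_x` for `x ∈ U`
(`exists_linearIsometry_of_inner_eq`, `inner_planeWave_sqrtFourier`). Hence `W = C* L*` is defined
on all of `L²` and `‖W φ_x‖² = u(0)` for `x ∈ U`. As `û` decays faster than every exponential,
`x ↦ φ_x` extends along each line to an entire `L²`-valued function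
(`SuperExpDecay.differentiable_planeWave`). So `‖W φ_x‖²` is real analytic along the line, and being
constant near a point of `U`, it equals `u(0) > 0` on the whole line
(`norm_sq_eq_of_eventually_eq`).

On the other hand `φ_x` tends weakly to zero as `x` goes to infinity on the line, by the
Riemann–Lebesgue lemma (`SuperExpDecay.tendsto_inner_planeWave`), so `L* φ_x` does too, and the
adjoint of the compact operator `C` sends it to a null sequence in norm
(`IsCompactOperator.tendsto_adjoint_of_weakly_null`): a contradiction.
-/

/-! ### Hilbert space preliminaries -/

/-- Two families of vectors with the same Gram matrix differ by a linear isometry, provided the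
first one is total. -/
theorem exists_linearIsometry_of_inner_eq {ι E F : Type*}
    [NormedAddCommGroup E] [InnerProductSpace ℂ E]
    [NormedAddCommGroup F] [InnerProductSpace ℂ F] [CompleteSpace F] (a : ι → E) (b : ι → F)
    (ha : (Submodule.span ℂ (Set.range a)).topologicalClosure = ⊤)
    (hab : ∀ i j, inner ℂ (a i) (a j) = inner ℂ (b i) (b j)) :
    ∃ L : E →ₗᵢ[ℂ] F, ∀ i, L (a i) = b i := by
  set A : (ι →₀ ℂ) →ₗ[ℂ] E := Finsupp.linearCombination ℂ a
  set B : (ι →₀ ℂ) →ₗ[ℂ] F := Finsupp.linearCombination ℂ b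
  have hdense : DenseRange A := by
    have h := Submodule.dense_iff_topologicalClosure_eq_top.2 ha
    rwa [← Finsupp.range_linearCombination] at h
  have hinner : ∀ x, inner ℂ (A x) (A x) = inner ℂ (B x) (B x) := fun x => by
    simp only [A, B, Finsupp.linearCombination_apply, Finsupp.sum_inner, Finsupp.inner_sum,
      inner_smul_left, inner_smul_right, hab]
  have hnorm : ∀ x, ‖B x‖ = ‖A x‖ := fun x => by
    rw [@norm_eq_sqrt_re_inner ℂ, @norm_eq_sqrt_re_inner ℂ, hinner]
  have hext : ∀ x, B.extendOfNorm A (A x) = B x :=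
    LinearMap.extendOfNorm_eq hdense ⟨1, fun x => by rw [one_mul, hnorm]⟩
  refine ⟨⟨(B.extendOfNorm A).toLinearMap, fun y => ?_⟩, fun i => ?_⟩
  · refine hdense.induction_on (p := fun y => ‖B.extendOfNorm A y‖ = ‖y‖) y
      (isClosed_eq (by fun_prop) (by fun_prop)) fun x => ?_
    rw [hext, hnorm]
  · simpa [A, B] using hext (Finsupp.single i 1)

/-- The adjoint of a compact operator maps bounded weakly null sequences to null sequences. -/
theorem IsCompactOperator.tendsto_adjoint_of_weakly_null {H H' : Type*}
    [NormedAddCommGroup H] [InnerProductSpace ℂ H] [CompleteSpace H]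
    [NormedAddCommGroup H'] [InnerProductSpace ℂ H'] [CompleteSpace H']
    {C : H →L[ℂ] H'} (hC : IsCompactOperator C) {v : ℕ → H'} {M : ℝ} (hM : ∀ n, ‖v n‖ ≤ M)
    (hv : ∀ y, Tendsto (fun n => inner ℂ (v n) y) atTop (nhds 0)) :
    Tendsto (fun n => C.adjoint (v n)) atTop (nhds 0) := by
  obtain ⟨K, hK, hCK⟩ := (hC.comp_clm C.adjoint).image_closedBall_subset_compact
    (f := (C ∘L C.adjoint).toLinearMap) M
  have hvK : ∀ n, C (C.adjoint (v n)) ∈ K := fun n =>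
    hCK ⟨v n, by simpa using hM n, rfl⟩
  refine tendsto_of_subseq_tendsto fun ns hns => ?_
  obtain ⟨y, -, ms, hms, hy⟩ := hK.tendsto_subseq fun n => hvK (ns n)
  refine ⟨ms, ?_⟩
  have hsub : Tendsto (fun n => ns (ms n)) atTop atTop := hns.comp hms.tendsto_atTop
  -- `‖C* v‖² = ⟨v, C C* v⟩`, where `C C* v` converges in norm along the subsequence
  have h1 : Tendsto (fun n => ‖v (ns (ms n))‖ * ‖C (C.adjoint (v (ns (ms n)))) - y‖ +
      ‖inner ℂ (v (ns (ms n))) y‖) atTop (nhds 0) := by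
    have h2 := (hv y).norm.comp hsub
    have h3 : Tendsto (fun n => ‖C (C.adjoint (v (ns (ms n)))) - y‖) atTop (nhds 0) :=
      tendsto_iff_norm_sub_tendsto_zero.1 hy
    have h4 : Tendsto (fun n => ‖v (ns (ms n))‖ * ‖C (C.adjoint (v (ns (ms n)))) - y‖) atTop
        (nhds 0) := by
      refine squeeze_zero (fun n => by positivity)
        (fun n => mul_le_mul_of_nonneg_right (hM _) (norm_nonneg _)) ?_
      simpa using h3.const_mul M
    simpa using h4.add h2
  have hsq : Tendsto (fun n => ‖C.adjoint (v (ns (ms n)))‖ ^ 2) atTop (nhds 0) := by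
    refine squeeze_zero (fun n => by positivity) (fun n => ?_) h1
    set w := v (ns (ms n))
    calc ‖C.adjoint w‖ ^ 2 = ‖inner ℂ w (C (C.adjoint w))‖ := by
          rw [← ContinuousLinearMap.adjoint_inner_left, inner_self_eq_norm_sq_to_K]
          simp
      _ = ‖inner ℂ w (C (C.adjoint w) - y) + inner ℂ w y‖ := by
          rw [← inner_add_right, sub_add_cancel]
      _ ≤ _ := (norm_add_le _ _).trans (by gcongr; exact norm_inner_le_norm _ _)
  rw [tendsto_zero_iff_norm_tendsto_zero]
  simpa using hsq.sqrt

/-- The squared norm of an entire Hilbert space valued function, restricted to the real line, is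
real analytic; hence it is constant as soon as it is constant near one point. -/
theorem norm_sq_eq_of_eventually_eq {H : Type*} [NormedAddCommGroup H] [InnerProductSpace ℂ H]
    [CompleteSpace H] {g : ℂ → H} (hg : Differentiable ℂ g) {c : ℝ}
    (hc : ∀ᶠ t : ℝ in nhds 0, ‖g t‖ ^ 2 = c) (t : ℝ) : ‖g t‖ ^ 2 = c := by
  have han : AnalyticOnNhd ℝ (fun t : ℝ => ‖g t‖ ^ 2) Set.univ := fun t _ => by
    have h1 : AnalyticAt ℝ (fun t : ℝ => g t) t :=
      ((hg.analyticAt (t : ℂ)).restrictScalars (𝕜 := ℝ)).comp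
        (f := fun t : ℝ => (t : ℂ)) (Complex.ofRealCLM.analyticAt t)
    let _ : InnerProductSpace ℝ H := InnerProductSpace.rclikeToReal ℂ H
    have h2 := ((innerSL ℝ (E := H)).analyticAt_bilinear (g t, g t)).comp
      (f := fun t : ℝ => (g t, g t)) (h1.prod h1)
    refine h2.congr (Eventually.of_forall fun s => ?_)
    exact real_inner_self_eq_norm_sq (g s)
  exact han.eqOn_of_preconnected_of_eventuallyEq (g := fun _ => c) (fun _ _ => analyticAt_const)
    isPreconnected_univ (Set.mem_univ 0) hc (Set.mem_univ t)

/-! ### Exponentials with a rapidly decaying density -/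

/-- `ψ` decays faster than every exponential: `|ψ(ξ)| ≤ c_a exp(-a|ξ|)` for all `a`. -/
def SuperExpDecay {d : ℕ} (ψ : Eu d → ℂ) : Prop :=
  ∀ a : ℝ, 0 < a → ∃ c : ℝ, ∀ᵐ ξ : Eu d, ‖ψ ξ‖ ≤ c * Real.exp (-a * ‖ξ‖)

theorem SuperExpDecay.memLp_exp_norm_mul {d : ℕ} {ψ : Eu d → ℂ} (hψ : SuperExpDecay ψ)
    (hm : AEStronglyMeasurable ψ) (R : ℝ) :
    MemLp (fun ξ : Eu d => (Real.exp (R * ‖ξ‖) : ℂ) * ψ ξ) 2 := by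
  have hmeas : AEStronglyMeasurable (fun ξ : Eu d => (Real.exp (R * ‖ξ‖) : ℂ) * ψ ξ) :=
    (Continuous.aestronglyMeasurable (by fun_prop)).mul hm
  -- the rate `|R| + d + 1` leaves a factor `exp(-(d+1)|ξ|) ≤ (1+|ξ|)^{-(d+1)}`
  obtain ⟨c, hc⟩ := hψ (|R| + (d + 1)) (by positivity)
  rw [memLp_two_iff_integrable_sq_norm hmeas]
  have hI : Integrable (fun ξ : Eu d => (1 + ‖ξ‖) ^ (-((d : ℝ) + 1))) :=
    integrable_one_add_norm (by simp)
  refine (hI.const_mul (c ^ 2)).mono' (by fun_prop) ?_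
  filter_upwards [hc] with ξ hξ
  have hn := norm_nonneg ξ
  have h1 : ‖(Real.exp (R * ‖ξ‖) : ℂ) * ψ ξ‖ ≤ c * Real.exp (-(d + 1) * ‖ξ‖) := by
    rw [norm_mul, Complex.norm_real, Real.norm_of_nonneg (Real.exp_nonneg _)]
    calc Real.exp (R * ‖ξ‖) * ‖ψ ξ‖
        ≤ Real.exp (|R| * ‖ξ‖) * (c * Real.exp (-(|R| + (d + 1)) * ‖ξ‖)) := by
          gcongr
          exact le_abs_self R
      _ = c * Real.exp (-(d + 1) * ‖ξ‖) := by
          rw [mul_left_comm, ← Real.exp_add]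
          ring_nf
  have hexp : Real.exp (-(d + 1) * ‖ξ‖) ≤ (1 + ‖ξ‖) ^ (-((d : ℝ) + 1)) := by
    rw [Real.rpow_def_of_pos (by positivity), mul_comm, Real.exp_le_exp]
    have := Real.log_le_sub_one_of_pos (x := 1 + ‖ξ‖) (by positivity)
    have hd : (0 : ℝ) ≤ d + 1 := by positivity
    nlinarith
  rw [Real.norm_of_nonneg (by positivity)]
  calc ‖(Real.exp (R * ‖ξ‖) : ℂ) * ψ ξ‖ ^ 2 ≤ (c * Real.exp (-(d + 1) * ‖ξ‖)) ^ 2 := by gcongr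
    _ = c ^ 2 * (Real.exp (-(d + 1) * ‖ξ‖) * Real.exp (-(d + 1) * ‖ξ‖)) := by ring
    _ ≤ c ^ 2 * ((1 + ‖ξ‖) ^ (-((d : ℝ) + 1)) * 1) := by
        gcongr
        rw [Real.exp_le_one_iff]
        have : (0 : ℝ) ≤ (d + 1) * ‖ξ‖ := by positivity
        linarith
    _ = _ := by rw [mul_one]

/-- The function `ξ ↦ exp(-2πi (p + τv)·ξ) ψ(ξ)` for a complex time `τ` on the line through `p`
in the real direction `v`. -/
noncomputable def planeWave {d : ℕ} (ψ : Eu d → ℂ) (p v : Eu d) (τ : ℂ) (ξ : Eu d) : ℂ :=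
  Complex.exp (-2 * Real.pi * Complex.I * (inner ℝ ξ p + τ * inner ℝ ξ v)) * ψ ξ

theorem planeWave_ofReal {d : ℕ} (ψ : Eu d → ℂ) (p v : Eu d) (t : ℝ) (ξ : Eu d) :
    planeWave ψ p v t ξ = Real.fourierChar (-inner ℝ ξ (p + t • v)) • ψ ξ := by
  rw [planeWave, Circle.smul_def, Real.fourierChar_apply, smul_eq_mul, inner_add_right,
    inner_smul_right]
  push_cast
  ring_nf

theorem norm_planeWave_le {d : ℕ} (ψ : Eu d → ℂ) (p v : Eu d) (τ : ℂ) (ξ : Eu d) :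
    ‖planeWave ψ p v τ ξ‖ ≤ Real.exp (‖τ‖ * (2 * Real.pi * ‖v‖) * ‖ξ‖) * ‖ψ ξ‖ := by
  rw [planeWave, norm_mul]
  gcongr
  have hsplit : -2 * Real.pi * Complex.I * (inner ℝ ξ p + τ * inner ℝ ξ v) =
      ((-2 * Real.pi * inner ℝ ξ p : ℝ) : ℂ) * Complex.I +
        -2 * Real.pi * Complex.I * (τ * inner ℝ ξ v) := by push_cast; ring
  rw [hsplit, Complex.exp_add, norm_mul, Complex.norm_exp_ofReal_mul_I, one_mul]
  refine (Complex.norm_exp_le_exp_norm _).trans (Real.exp_le_exp.2 ?_)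
  have hpi := Real.pi_pos
  calc ‖-2 * Real.pi * Complex.I * (τ * (inner ℝ ξ v : ℂ))‖
      = 2 * Real.pi * ‖τ‖ * |inner ℝ ξ v| := by
        simp [abs_of_pos hpi]
        ring
    _ ≤ 2 * Real.pi * ‖τ‖ * (‖ξ‖ * ‖v‖) := by gcongr; exact abs_real_inner_le_norm _ _
    _ = _ := by ring

theorem SuperExpDecay.memLp_planeWave {d : ℕ} {ψ : Eu d → ℂ} (hψ : SuperExpDecay ψ)
    (hm : AEStronglyMeasurable ψ) (p v : Eu d) (τ : ℂ) : MemLp (planeWave ψ p v τ) 2 := by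
  refine (hψ.memLp_exp_norm_mul hm (‖τ‖ * (2 * Real.pi * ‖v‖))).of_le
    ((Continuous.aestronglyMeasurable (by fun_prop)).mul hm) (Eventually.of_forall fun ξ => ?_)
  refine (norm_planeWave_le ψ p v τ ξ).trans (le_of_eq ?_)
  rw [norm_mul, Complex.norm_real, Real.norm_of_nonneg (Real.exp_nonneg _)]

theorem SuperExpDecay.toLp_planeWave_ofReal {d : ℕ} {ψ : Eu d → ℂ} (hψ : SuperExpDecay ψ)
    (hm : AEStronglyMeasurable ψ) (p v : Eu d) (t : ℝ) :
    (hψ.memLp_planeWave hm p v (t : ℂ)).toLp =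
      (hψ.memLp_planeWave hm 0 (p + t • v) ((1 : ℝ) : ℂ)).toLp := by
  congr 1
  funext ξ
  rw [planeWave_ofReal, planeWave_ofReal, zero_add, one_smul]

/-- The pointwise second order Taylor bound for `τ ↦ exp(-2πi (p + τv)·ξ) ψ(ξ)`. -/
theorem norm_planeWave_sub_sub_le {d : ℕ} (ψ : Eu d → ℂ) (p v : Eu d) (τ h : ℂ) (hh : ‖h‖ ≤ 1)
    (ξ : Eu d) :
    ‖planeWave ψ p v (τ + h) ξ - planeWave ψ p v τ ξ -
        h * (-2 * Real.pi * Complex.I * inner ℝ ξ v * planeWave ψ p v τ ξ)‖ ≤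
      ‖h‖ ^ 2 * (Real.exp ((‖τ‖ + 3) * (2 * Real.pi * ‖v‖) * ‖ξ‖) * ‖ψ ξ‖) := by
  have hpi := Real.pi_pos
  set θ : ℂ := -2 * Real.pi * Complex.I * inner ℝ ξ v with hθ
  set r : ℝ := 2 * Real.pi * ‖v‖ * ‖ξ‖ with hr
  have hθr : ‖θ‖ ≤ r := by
    calc ‖θ‖ = 2 * Real.pi * |inner ℝ ξ v| := by simp [hθ, abs_of_pos hpi]
      _ ≤ 2 * Real.pi * (‖ξ‖ * ‖v‖) := by gcongr; exact abs_real_inner_le_norm _ _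
      _ = r := by rw [hr]; ring
  have hr0 : 0 ≤ r := (norm_nonneg _).trans hθr
  have hfac : planeWave ψ p v (τ + h) ξ - planeWave ψ p v τ ξ - h * (θ * planeWave ψ p v τ ξ) =
      (Complex.exp (h * θ) - 1 - h * θ) * planeWave ψ p v τ ξ := by
    have : planeWave ψ p v (τ + h) ξ = Complex.exp (h * θ) * planeWave ψ p v τ ξ := by
      rw [planeWave, planeWave, ← mul_assoc, ← Complex.exp_add, hθ]
      ring_nf
    rw [this]
    ring
  have hexp : ‖Complex.exp (h * θ) - 1 - h * θ‖ ≤ ‖h‖ ^ 2 * Real.exp (3 * r) := by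
    have h1 := Complex.norm_exp_sub_sum_le_norm_mul_exp (h * θ) 2
    simp only [Finset.sum_range_succ, Finset.sum_range_zero, zero_add, pow_zero, pow_one,
      Nat.factorial, Nat.cast_one, div_one, mul_one, ← sub_sub] at h1
    refine h1.trans ?_
    rw [norm_mul, mul_pow, mul_assoc]
    have hrexp : r ≤ Real.exp r := (by linarith : r ≤ r + 1).trans (Real.add_one_le_exp r)
    gcongr
    calc ‖θ‖ ^ 2 * Real.exp (‖h‖ * ‖θ‖) ≤ Real.exp r ^ 2 * Real.exp (1 * r) := by
          gcongr
          exact hθr.trans hrexp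
      _ = Real.exp (3 * r) := by
          rw [← Real.exp_nat_mul, ← Real.exp_add]
          push_cast
          ring_nf
  rw [hfac, norm_mul]
  calc _ ≤ ‖h‖ ^ 2 * Real.exp (3 * r) *
        (Real.exp (‖τ‖ * (2 * Real.pi * ‖v‖) * ‖ξ‖) * ‖ψ ξ‖) := by
        gcongr
        exact norm_planeWave_le ψ p v τ ξ
    _ = ‖h‖ ^ 2 * ((Real.exp (3 * r) *
        Real.exp (‖τ‖ * (2 * Real.pi * ‖v‖) * ‖ξ‖)) * ‖ψ ξ‖) := by ring
    _ = _ := by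
        rw [← Real.exp_add, hr]
        ring_nf

/-- For a density decaying faster than every exponential, `τ ↦ exp(-2πi (p + τv)·ξ) ψ(ξ)` is an
entire function with values in `L²(ℝ^d)`. -/
theorem SuperExpDecay.differentiable_planeWave {d : ℕ} {ψ : Eu d → ℂ} (hψ : SuperExpDecay ψ)
    (hm : AEStronglyMeasurable ψ) (p v : Eu d) :
    Differentiable ℂ fun τ => (hψ.memLp_planeWave hm p v τ).toLp := by
  intro τ
  set E : ℂ → Lp (α := Eu d) ℂ 2 := fun τ => (hψ.memLp_planeWave hm p v τ).toLp with hE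
  set D : Eu d → ℂ := fun ξ => -2 * Real.pi * Complex.I * inner ℝ ξ v * planeWave ψ p v τ ξ
  have hM := hψ.memLp_exp_norm_mul hm ((‖τ‖ + 3) * (2 * Real.pi * ‖v‖))
  have hDm : AEStronglyMeasurable D :=
    (Continuous.aestronglyMeasurable (by fun_prop)).mul
      (hψ.memLp_planeWave hm p v τ).aestronglyMeasurable
  have hMnorm : ∀ ξ : Eu d, ‖(Real.exp ((‖τ‖ + 3) * (2 * Real.pi * ‖v‖) * ‖ξ‖) : ℂ) * ψ ξ‖ =
      Real.exp ((‖τ‖ + 3) * (2 * Real.pi * ‖v‖) * ‖ξ‖) * ‖ψ ξ‖ := fun ξ => by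
    rw [norm_mul, Complex.norm_real, Real.norm_of_nonneg (Real.exp_nonneg _)]
  -- the Taylor bound with `h = 1` exhibits the derivative as a sum of square-integrable functions
  have hD : MemLp D 2 := by
    have hrem : MemLp (fun ξ => planeWave ψ p v (τ + 1) ξ - planeWave ψ p v τ ξ - D ξ) 2 := by
      refine hM.of_le (((hψ.memLp_planeWave hm p v (τ + 1)).aestronglyMeasurable.sub
        (hψ.memLp_planeWave hm p v τ).aestronglyMeasurable).sub hDm)
        (Eventually.of_forall fun ξ => ?_)
      have := norm_planeWave_sub_sub_le ψ p v τ 1 (by simp) ξ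
      rw [hMnorm]
      simpa [D] using this
    refine (((hψ.memLp_planeWave hm p v (τ + 1)).sub (hψ.memLp_planeWave hm p v τ)).sub
      hrem).ae_eq (Eventually.of_forall fun ξ => ?_)
    simp
  refine HasDerivAt.differentiableAt (f' := hD.toLp) ?_
  rw [hasDerivAt_iff_isLittleO_nhds_zero]
  refine (Asymptotics.IsBigO.of_bound ‖hM.toLp‖ (g := fun h : ℂ => h ^ 2) ?_).trans_isLittleO
    (Asymptotics.isLittleO_pow_id one_lt_two)
  filter_upwards [Metric.closedBall_mem_nhds (0 : ℂ) one_pos] with h hh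
  have hh1 : ‖h‖ ≤ 1 := by simpa using hh
  rw [norm_pow, mul_comm, ← norm_pow, ← norm_smul]
  refine Lp.norm_le_norm_of_ae_le ?_
  filter_upwards [Lp.coeFn_sub (E (τ + h) - E τ) (h • hD.toLp), Lp.coeFn_sub (E (τ + h)) (E τ),
    Lp.coeFn_smul h hD.toLp, Lp.coeFn_smul (h ^ 2) hM.toLp, hD.coeFn_toLp, hM.coeFn_toLp,
    (hψ.memLp_planeWave hm p v (τ + h)).coeFn_toLp, (hψ.memLp_planeWave hm p v τ).coeFn_toLp]
    with ξ h1 h2 h3 h4 h5 h6 h7 h8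
  rw [h1, Pi.sub_apply, h2, Pi.sub_apply, h3, Pi.smul_apply, h4, Pi.smul_apply, h5, h6, hE, h7,
    h8, norm_smul, hMnorm, norm_pow]
  exact norm_planeWave_sub_sub_le ψ p v τ h hh1 ξ

/-- The Riemann–Lebesgue lemma: along a real line the functions `exp(-2πi x·ξ) ψ(ξ)` tend weakly
to zero. -/
theorem SuperExpDecay.tendsto_inner_planeWave {d : ℕ} {ψ : Eu d → ℂ} (hψ : SuperExpDecay ψ)
    (hm : AEStronglyMeasurable ψ) (p : Eu d) {v : Eu d} (hv : v ≠ 0) (y : Lp (α := Eu d) ℂ 2) :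
    Tendsto (fun n : ℕ => inner ℂ (hψ.memLp_planeWave hm p v ((n : ℝ) : ℂ)).toLp y) atTop
      (nhds 0) := by
  have hline : Tendsto (fun n : ℕ => p + (n : ℝ) • v) atTop (cocompact (Eu d)) := by
    have hsmul : Tendsto (fun n : ℕ => (n : ℝ) • v) atTop (cocompact (Eu d)) := by
      rw [← Metric.cobounded_eq_cocompact, ← tendsto_norm_atTop_iff_cobounded]
      simp only [norm_smul, Real.norm_natCast]
      exact tendsto_natCast_atTop_atTop.atTop_mul_const (norm_pos_iff.2 hv)
    exact (Homeomorph.addLeft p).isClosedEmbedding.tendsto_cocompact.comp hsmul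
  have h := (tendsto_integral_exp_inner_smul_cocompact
    (fun ξ : Eu d => ψ ξ * conj ((y : Eu d → ℂ) ξ))).comp hline
  have hconj := h.star
  rw [star_zero] at hconj
  refine hconj.congr fun n => ?_
  rw [← inner_conj_symm, L2.inner_def]
  refine congrArg star (integral_congr_ae ?_)
  filter_upwards [(hψ.memLp_planeWave hm p v ((n : ℝ) : ℂ)).coeFn_toLp] with ξ hξ
  rw [hξ, planeWave_ofReal, RCLike.inner_apply, Circle.smul_def, Circle.smul_def]
  simp only [smul_eq_mul]
  ring

/-! ### The feature map of the kernel -/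

/-- The function `√û`, as a complex valued one. -/
noncomputable def sqrtFourier {d : ℕ} {u : Eu d → ℂ} (hu : MemLp u 2) (ξ : Eu d) : ℂ :=
  (Real.sqrt (fourierL2 hu ξ).re : ℂ)

theorem aestronglyMeasurable_sqrtFourier {d : ℕ} {u : Eu d → ℂ} (hu : MemLp u 2) :
    AEStronglyMeasurable (sqrtFourier hu) :=
  (Complex.continuous_ofReal.comp (Real.continuous_sqrt.comp
    Complex.continuous_re)).comp_aestronglyMeasurable (Lp.aestronglyMeasurable (fourierL2 hu))

theorem superExpDecay_sqrtFourier {d : ℕ} {u : Eu d → ℂ} (hu : MemLp u 2)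
    (hA : ∀ a : ℝ, 0 < a → ∃ c : ℝ, 0 < c ∧
      ∀ᵐ ξ, ‖fourierL2 hu ξ‖ ≤ c * Real.exp (-a * ‖ξ‖)) :
    SuperExpDecay (sqrtFourier hu) := by
  intro a ha
  obtain ⟨c, hc, h⟩ := hA (2 * a) (by positivity)
  refine ⟨Real.sqrt c, ?_⟩
  filter_upwards [h] with ξ hξ
  rw [sqrtFourier, Complex.norm_real, Real.norm_of_nonneg (Real.sqrt_nonneg _)]
  refine Real.sqrt_le_iff.2 ⟨by positivity, ?_⟩
  rw [mul_pow, Real.sq_sqrt hc.le, ← Real.exp_nat_mul]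
  refine (Complex.re_le_norm _).trans (hξ.trans (le_of_eq ?_))
  push_cast
  ring_nf

/-- The Gram matrix of the functions `ξ ↦ exp(-2πi x·ξ) √û(ξ)` in `L²(ℝ^d)` is the kernel
`u (x - y)`. -/
theorem inner_planeWave_sqrtFourier {d : ℕ} {u : Eu d → ℂ} (hu : MemLp u 2) (hc : Continuous u)
    (h1 : Integrable (fourierL2 hu : Eu d → ℂ)) (hpos : ∀ᵐ ξ, 0 ≤ (fourierL2 hu : Eu d → ℂ) ξ)
    (hψ : SuperExpDecay (sqrtFourier hu)) (x y : Eu d) :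
    inner ℂ (hψ.memLp_planeWave (aestronglyMeasurable_sqrtFourier hu) 0 x ((1 : ℝ) : ℂ)).toLp
      (hψ.memLp_planeWave (aestronglyMeasurable_sqrtFourier hu) 0 y ((1 : ℝ) : ℂ)).toLp =
        u (x - y) := by
  conv_rhs => rw [eq_fourierInv hu hc h1, Real.fourierInv_eq]
  rw [L2.inner_def]
  refine integral_congr_ae ?_
  have hm := aestronglyMeasurable_sqrtFourier hu
  filter_upwards [(hψ.memLp_planeWave hm 0 x ((1 : ℝ) : ℂ)).coeFn_toLp,
    (hψ.memLp_planeWave hm 0 y ((1 : ℝ) : ℂ)).coeFn_toLp, hpos] with ξ hx hy hξ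
  have hre : ((fourierL2 hu ξ).re : ℂ) = fourierL2 hu ξ :=
    (Complex.eq_re_of_ofReal_le hξ).symm
  have hsq : sqrtFourier hu ξ * sqrtFourier hu ξ = fourierL2 hu ξ := by
    rw [sqrtFourier, ← Complex.ofReal_mul, Real.mul_self_sqrt (Complex.le_def.1 hξ).1, hre]
  have hconj : conj (sqrtFourier hu ξ) = sqrtFourier hu ξ := Complex.conj_ofReal _
  rw [hx, hy, planeWave_ofReal, planeWave_ofReal, RCLike.inner_apply, zero_add, zero_add, one_smul,
    one_smul, inner_sub_right, sub_eq_add_neg, AddChar.map_add_eq_mul, AddChar.map_neg_eq_inv,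
    AddChar.map_neg_eq_inv]
  simp only [Circle.smul_def, smul_eq_mul, map_mul, hconj, Circle.coe_mul, Circle.coe_inv_eq_conj,
    Complex.conj_conj]
  rw [← hsq]
  ring

theorem norm_sq_kerFun {X : Type*} (k : X → X → ℂ) (hk : IsPosDefKernel k) (x : X) :
    ‖RKHS.kerFun (RKHSpace k hk) x 1‖ ^ 2 = (k x x).re := by
  rw [← RKHSpace.kerFun_apply k hk, ← RKHSpace.inner_kerFun, inner_self_eq_norm_sq_to_K]
  norm_cast

/-- A nonzero translation-invariant positive definite kernel has positive diagonal. -/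
theorem re_apply_zero_pos {d : ℕ} {u : Eu d → ℂ} (hk : IsPosDefKernel fun x y : Eu d => u (x - y))
    (hne : u ≠ 0) : 0 < (u 0).re := by
  set κ := fun x => RKHS.kerFun (RKHSpace _ hk) x 1
  have hn : ∀ x, ‖κ x‖ ^ 2 = (u 0).re := fun x => by simpa using norm_sq_kerFun _ hk x
  refine lt_of_le_of_ne ((sq_nonneg _).trans_eq (hn 0)) fun h0 => hne (funext fun x => ?_)
  have hκ : κ 0 = 0 := by simpa [← h0] using hn 0
  have := RKHSpace.kerFun_apply _ hk x 0
  rw [show RKHS.kerFun (RKHSpace _ hk) 0 1 = 0 from hκ] at this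
  simpa using this.symm

/-- The kernel functions of a reproducing kernel Hilbert space of scalar functions are total. -/
theorem topologicalClosure_span_kerFun {X : Type*} (k : X → X → ℂ) (hk : IsPosDefKernel k) :
    (Submodule.span ℂ (Set.range fun x => RKHS.kerFun (RKHSpace k hk) x 1)).topologicalClosure =
      ⊤ := by
  rw [eq_top_iff, ← RKHS.kerFun_dense (RKHSpace k hk)]
  refine Submodule.topologicalClosure_mono (Submodule.span_le.2 ?_)
  rintro _ ⟨x, c, rfl⟩
  have : RKHS.kerFun (RKHSpace k hk) x c = c • RKHS.kerFun (RKHSpace k hk) x 1 := by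
    rw [← map_smul, smul_eq_mul, mul_one]
  rw [this]
  exact Submodule.smul_mem _ _ (Submodule.subset_span ⟨x, rfl⟩)

/-! ### Compact composition operators -/

/-- A compact composition operator is a bounded operator defined everywhere, and its adjoint maps
the kernel function at `x` to the kernel function at `f x`. -/
theorem exists_clm_of_isCompactOp_compositionOp {X Y H H' : Type*}
    [NormedAddCommGroup H] [InnerProductSpace ℂ H] [RKHS ℂ H Y ℂ] [CompleteSpace H]
    [NormedAddCommGroup H'] [InnerProductSpace ℂ H'] [RKHS ℂ H' X ℂ] [CompleteSpace H']
    {f : X → Y} (h : (compositionOp H H' f).IsCompactOp) :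
    ∃ C : H →L[ℂ] H', IsCompactOperator C ∧
      ∀ x, C.adjoint (RKHS.kerFun H' x 1) = RKHS.kerFun H (f x) 1 := by
  obtain ⟨hdom, hcomp⟩ := h
  set ι : H →L[ℂ] (compositionOp H H' f).domain :=
    (ContinuousLinearMap.id ℂ H).codRestrict _ fun x => by rw [hdom]; trivial
  have hC := hcomp.comp_clm ι
  refine ⟨ContinuousLinearMap.mkOfIsCompactOperator
    (f := (compositionOp H H' f).toFun ∘ₗ ι.toLinearMap) hC, hC, fun x => ?_⟩
  refine ext_inner_right ℂ fun g => ?_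
  rw [ContinuousLinearMap.adjoint_inner_left, RKHS.kerFun_inner, RKHS.kerFun_inner]
  congr 1
  exact congrFun (compositionOp_apply f (ι g)) x

/-- Let `φ` be a feature map of the kernel `u (x - y)` that, along a real line through any given
point, extends to an entire function and tends weakly to zero at infinity. Then no composition
operator into the space of the kernel restricted to a nonempty open set is compact. -/
theorem not_isCompactOp_compositionOp_of_featureMap {d : ℕ} {u : Eu d → ℂ} (hne : u ≠ 0)
    {G : Type*} [NormedAddCommGroup G] [InnerProductSpace ℂ G] [CompleteSpace G] {φ : Eu d → G}
    (hgram : ∀ x y, inner ℂ (φ x) (φ y) = u (x - y))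
    (hline : ∀ p, ∃ (v : Eu d) (E : ℂ → G), Differentiable ℂ E ∧
      (∀ t : ℝ, E t = φ (p + t • v)) ∧
      ∀ y, Tendsto (fun n : ℕ => inner ℂ (E (n : ℝ)) y) atTop (nhds 0))
    {U : Set (Eu d)} (hU : IsOpen U) (hUne : U.Nonempty) (f : U → Eu d)
    (hk : IsPosDefKernel fun x y : Eu d => u (x - y))
    (hk' : IsPosDefKernel fun x y : U => u (x - y)) :
    ¬ (compositionOp (RKHSpace _ hk) (RKHSpace _ hk') f).IsCompactOp := by
  intro hcompact
  obtain ⟨C, hCc, hCadj⟩ := exists_clm_of_isCompactOp_compositionOp hcompact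
  obtain ⟨L, hL⟩ := exists_linearIsometry_of_inner_eq
    (fun x : U => RKHS.kerFun (RKHSpace _ hk') x 1) (fun x : U => φ x)
    (topologicalClosure_span_kerFun _ hk') fun x y => by
      rw [RKHSpace.inner_kerFun, RKHSpace.kerFun_apply, hgram]
  set Lc := L.toContinuousLinearMap
  have hLadj : ∀ x : U, Lc.adjoint (φ x) = RKHS.kerFun (RKHSpace _ hk') x 1 := fun x => by
    refine ext_inner_right ℂ fun g => ?_
    rw [ContinuousLinearMap.adjoint_inner_left, ← hL]
    exact L.inner_map_map _ _
  set W := C.adjoint ∘L Lc.adjoint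
  have hWU : ∀ x ∈ U, ‖W (φ x)‖ ^ 2 = (u 0).re := fun x hx => by
    change ‖C.adjoint (Lc.adjoint (φ x))‖ ^ 2 = _
    rw [hLadj ⟨x, hx⟩, hCadj, norm_sq_kerFun]
    simp
  obtain ⟨p, hp⟩ := hUne
  obtain ⟨v, E, hEdiff, hE, hEnull⟩ := hline p
  have hconst : ∀ t : ℝ, ‖W (E t)‖ ^ 2 = (u 0).re := by
    refine norm_sq_eq_of_eventually_eq (W.differentiable.comp hEdiff) ?_
    have hpt : Tendsto (fun t : ℝ => p + t • v) (nhds 0) (nhds p) := by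
      have : Continuous fun t : ℝ => p + t • v := by fun_prop
      simpa using this.tendsto 0
    filter_upwards [hpt.eventually (hU.mem_nhds hp)] with t ht
    rw [Function.comp_apply, hE]
    exact hWU _ ht
  have hnull : Tendsto (fun n : ℕ => W (E (n : ℝ))) atTop (nhds 0) := by
    refine hCc.tendsto_adjoint_of_weakly_null (v := fun n : ℕ => Lc.adjoint (E (n : ℝ)))
      (M := ‖Lc.adjoint‖ * Real.sqrt (u 0).re) (fun n => (Lc.adjoint.le_opNorm _).trans ?_)
      fun y => ?_
    · refine mul_le_mul_of_nonneg_left (le_of_eq ?_) (norm_nonneg _)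
      rw [hE, @norm_eq_sqrt_re_inner ℂ, hgram, sub_self]
      rfl
    · simp_rw [ContinuousLinearMap.adjoint_inner_left]
      exact hEnull _
  have h0 := (hnull.norm.pow 2).congr fun n : ℕ => hconst n
  rw [norm_zero, zero_pow two_ne_zero] at h0
  exact (re_apply_zero_pos hk hne).ne' (tendsto_nhds_unique tendsto_const_nhds h0)

theorem mainTheorem4 (d : ℕ) (hd : 0 < d) (u : Eu d → ℂ)
    (hcont : Continuous u) (hu : MemLp u 2) (hne : u ≠ 0)
    (hint : Integrable (fourierL2 hu)) (hbdd : MemLp (fourierL2 hu) ⊤)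
    (hpos : ∀ᵐ ξ, 0 ≤ fourierL2 hu ξ)
    (hA : ∀ a : ℝ, 0 < a → ∃ c : ℝ, 0 < c ∧
      ∀ᵐ ξ, ‖fourierL2 hu ξ‖ ≤ c * Real.exp (-a * ‖ξ‖))
    (hB : (⨆ z : Fin d → ℂ,
      limsup (fun n : ℕ => expMulNorm hu z n ^ (1 / (n : ℝ))) atTop) < (⊤ : ℝ≥0∞))
    (hC : Submodule.span ℝ (dilationSet hu) = ⊤)
    (U : Set (Eu d)) (hU : IsOpen U) (hUne : U.Nonempty) (f : U → Eu d) :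
    ¬ (compositionOp
        (RKHSpace (fun x y : Eu d => u (x - y))
          (isPosDefKernel_of_fourier_nonneg hu hcont hint hpos))
        (RKHSpace (fun x y : U => u (x - y))
          ((isPosDefKernel_of_fourier_nonneg hu hcont hint hpos).comp Subtype.val_injective))
        f).IsCompactOp := by
  have hm := aestronglyMeasurable_sqrtFourier hu
  have hψ := superExpDecay_sqrtFourier hu hA
  obtain ⟨v, hv⟩ : ∃ v : Eu d, v ≠ 0 := ⟨EuclideanSpace.single ⟨0, hd⟩ 1, by simp⟩
  exact not_isCompactOp_compositionOp_of_featureMap hne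
    (inner_planeWave_sqrtFourier hu hcont hint hpos hψ)
    (fun p => ⟨v, _, hψ.differentiable_planeWave hm p v, hψ.toLp_planeWave_ofReal hm p v,
      hψ.tendsto_inner_planeWave hm p hv⟩) hU hUne f _ _
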